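/- **Directional derivative for NN training with QAMC (classical direction $v$).** *Network.* Let $f_{\mathrm{NN}}(\theta;x)\in\mathbb{R}$ be the output (scalar loss included) of a network with $n_\theta$ trainable parameters $\theta\in\mathbb{R}^{n_\theta}$ and input $x\in\mathbb{R}^d$. Let $\theta$ be the current parameters. Let the input $X$ be a random vector taking the value $X_i\in\mathbb{R}^d$ with probability $p_i$, $i\in\{0,1\}^n$, and assume that $f_{\mathrm{NN}}(\cdot\,;X_i)$ is differentiable at $\theta$ whenever $p_i>0$. Write $\nabla f_{\mathrm{NN}}(X)$ for the gradient with respect to the trainable parameters at $\theta$, and put $$g_{\max}=\max_{i:\,p_i>0}\|\nabla f_{\mathrm{NN}}(X_i)\|_\infty^2 .$$ Let $v\in\mathbb{R}^{n_\theta}$ be a fixed vector known to the algorithm (for instance a classical sample with i.i.d. $\mathcal N(0,1)$ entries). *Access.* A fixed-point register with $c_1$ integer bits $a$, $c_2$ fractional bits $b$ and a sign bit $s$ encodes $Q(a,b,s)=(-1)^s\big(\sum_{j<c_1}2^ja^{(j)}+\sum_{j<c_2}2^{-j-1}b^{(j)}\big)$. We are given two unitaries: $U_p$ with $U_p|0\cdots0\rangle=\sum_i\sqrt{p_i}\,|i\rangle$,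 and $U'_{\mathrm{NN},c}$ with $U'_{\mathrm{NN},c}|i\rangle|0\rangle=|i\rangle|w_i\rangle$ for all $i$, where $w_i$ is a fixed-point bit pattern with $|Q(w_i)-\nabla f_{\mathrm{NN}}(X_i)\cdot v|\le\eta$ whenever $p_i>0$; here $\eta$ is the rounding error of the stored values ($\eta=0$ for exact storage). A query algorithm runs finitely many quantum circuits, each built from fixed unitaries and from queries to $U_p$, $U'_{\mathrm{NN},c}$ and their inverses, measures them in the computational basis, and computes an estimate classically from the outcomes. *Claim.* First, $$\mathrm{Var}\big[\nabla f_{\mathrm{NN}}(X)\cdot v\big]\le g_{\max}\,n_\theta\,\|v\|_2^2 .$$ Second, there are universal constants $C>0$ and $k\in\mathbb{N}$ such that for all $d,n_\theta,n,c_1,c_2$, all $v$, all $\epsilon>0$ and all $g\ge0$ there is a query algorithm, depending only on these data (and not on $f_{\mathrm{NN}},\theta,p,X,U_p,U'_{\mathrm{NN},c},\eta$), that makes at most $$C\,r\,\big(\log(2+r)\big)^k=\tilde O\!\left(\frac{\sqrt{g\,n_\theta}\,\|v\|_2}{\epsilon}\right),\qquad r=\frac{\sqrt{g\,n_\theta}\,\|v\|_2}{\epsilon},$$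 queries to $U'_{\mathrm{NN},c}$ and its inverse, and at most as many to $U_p$ and its inverse, and that for every network, parameters, input distribution and unitaries as above with $g_{\max}\le g$ outputs an estimate of $\mathbb{E}[\nabla f_{\mathrm{NN}}(X)\cdot v]$ with additive error at most $\epsilon+\eta$ with probability at least $0.99$. In particular, with $g=g_{\max}$ and $\eta=0$, $\tilde O(\sqrt{g_{\max}n_\theta}\,\|v\|_2/\epsilon)$ queries suffice for additive error $\epsilon$. -/

import Mathlib

noncomputable section

namespace QAMC

/-! ### Registers and fixed-point numbers -/

/-- Bit strings of length `n`; they label the computational basis of an `n`-qubit register. -/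
abbrev BitString (n : ℕ) : Type := Fin n → Bool

/-- The label of the basis state `|0⋯0⟩`. -/
def zeroBits (n : ℕ) : BitString n := fun _ => false

/-- Bit patterns `(a, b, s)` of a signed fixed-point number with `c₁` integer bits `a`,
`c₂` fractional bits `b` and a sign bit `s`. -/
abbrev FixedPoint (c₁ c₂ : ℕ) : Type := BitString c₁ × BitString c₂ × Bool

/-- The label of the basis state `|0⋯0⟩` of a fixed-point register. -/
def zeroFixed (c₁ c₂ : ℕ) : FixedPoint c₁ c₂ := (zeroBits c₁, zeroBits c₂, false)

/-- The number encoded by a bit pattern: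
`(-1)^s (∑ⱼ 2^j a⁽ʲ⁾ + ∑ⱼ 2^(-(j+1)) b⁽ʲ⁾)`. -/
def fixedPointValue {c₁ c₂ : ℕ} (q : FixedPoint c₁ c₂) : ℝ :=
  (if q.2.2 then (-1 : ℝ) else 1) *
    ((∑ j : Fin c₁, if q.1 j then (2 : ℝ) ^ (j : ℕ) else 0) +
      ∑ j : Fin c₂, if q.2.1 j then ((2 : ℝ) ^ ((j : ℕ) + 1))⁻¹ else 0)

/-- The computational basis vector `|i⟩`. -/
def ket {ι : Type} [DecidableEq ι] (i : ι) : ι → ℂ := Pi.single i 1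

/-! ### The two unitaries the algorithm has access to -/

/-- Quantum loading of a probability distribution: `U |0⋯0⟩ = ∑ₓ √(p x) |x⟩`. -/
def LoadsDistribution {n : ℕ} (p : PMF (BitString n))
    (U : Matrix.unitaryGroup (BitString n) ℂ) : Prop :=
  Matrix.mulVec (U : Matrix (BitString n) (BitString n) ℂ) (ket (zeroBits n)) =
    fun x => ((Real.sqrt (p x).toReal : ℝ) : ℂ)

/-- The unitary `U` writes the bit pattern `w x` into a blank output register:
`U |x⟩|0⟩ = |x⟩|w x⟩` for every basis state `|x⟩`. -/
def Writes {n c₁ c₂ : ℕ} (w : BitString n → FixedPoint c₁ c₂)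
    (U : Matrix.unitaryGroup (BitString n × FixedPoint c₁ c₂) ℂ) : Prop :=
  ∀ x : BitString n,
    Matrix.mulVec
        (U : Matrix (BitString n × FixedPoint c₁ c₂) (BitString n × FixedPoint c₁ c₂) ℂ)
        (ket (x, zeroFixed c₁ c₂)) =
      ket (x, w x)

/-! ### Quantum query algorithms -/

/-- Basis labels of the whole machine: input register, output register, `anc` further qubits. -/
abbrev Basis (n c₁ c₂ anc : ℕ) : Type :=
  (BitString n × FixedPoint c₁ c₂) × BitString anc

instance (n c₁ c₂ anc : ℕ) : DecidableEq (Basis n c₁ c₂ anc) := instDecidableEqProd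

/-- One step of a query circuit: a fixed unitary on all qubits, or a query to one of the two
given unitaries or to its inverse. -/
inductive Gate (n c₁ c₂ anc : ℕ) : Type where
  | free (W : Matrix.unitaryGroup (Basis n c₁ c₂ anc) ℂ) : Gate n c₁ c₂ anc
  | load : Gate n c₁ c₂ anc
  | loadInv : Gate n c₁ c₂ anc
  | eval : Gate n c₁ c₂ anc
  | evalInv : Gate n c₁ c₂ anc

/-- The matrix of a step when the loading unitary is `P` (acting on the input register) and the
evaluating unitary is `U` (acting on the input and the output register). -/
def Gate.toMatrix {n c₁ c₂ anc : ℕ} (P : Matrix.unitaryGroup (BitString n) ℂ)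
    (U : Matrix.unitaryGroup (BitString n × FixedPoint c₁ c₂) ℂ) :
    Gate n c₁ c₂ anc → Matrix (Basis n c₁ c₂ anc) (Basis n c₁ c₂ anc) ℂ
  | .free W => W.1
  | .load => Matrix.kronecker (Matrix.kronecker P.1 1) 1
  | .loadInv => Matrix.kronecker (Matrix.kronecker (P⁻¹).1 1) 1
  | .eval => Matrix.kronecker U.1 1
  | .evalInv => Matrix.kronecker (U⁻¹).1 1

/-- Number of queries (`1` or `0`) that a step makes to the evaluating unitary or its inverse. -/
def Gate.evalCost {n c₁ c₂ anc : ℕ} : Gate n c₁ c₂ anc → ℕ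
  | .eval => 1
  | .evalInv => 1
  | _ => 0

/-- Number of queries (`1` or `0`) that a step makes to the loading unitary or its inverse. -/
def Gate.loadCost {n c₁ c₂ anc : ℕ} : Gate n c₁ c₂ anc → ℕ
  | .load => 1
  | .loadInv => 1
  | _ => 0

/-- The state after the steps of a circuit have been applied, from the head of the list on, to
`|0⋯0⟩`. -/
def finalState {n c₁ c₂ anc : ℕ} (P : Matrix.unitaryGroup (BitString n) ℂ)
    (U : Matrix.unitaryGroup (BitString n × FixedPoint c₁ c₂) ℂ)
    (circuit : List (Gate n c₁ c₂ anc)) : Basis n c₁ c₂ anc → ℂ :=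
  circuit.foldl (fun ψ G => Matrix.mulVec (G.toMatrix P U) ψ)
    (ket ((zeroBits n, zeroFixed c₁ c₂), zeroBits anc))

/-- A quantum query algorithm for estimating a real number: a finite number of circuits, each run
once from `|0⋯0⟩` and measured in the computational basis, followed by classical post-processing
of the outcomes. The circuits and the post-processing do not depend on the queried unitaries. -/
structure QueryAlgorithm (n c₁ c₂ : ℕ) : Type where
  /-- number of ancilla qubits -/
  anc : ℕ
  /-- number of circuits that are run -/
  runs : ℕ
  /-- the circuits -/
  circuit : Fin runs → List (Gate n c₁ c₂ anc)
  /-- the estimate computed from the measurement outcomes -/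
  estimate : (Fin runs → Basis n c₁ c₂ anc) → ℝ

/-- Total number of queries to the evaluating unitary and its inverse. -/
def QueryAlgorithm.evalQueries {n c₁ c₂ : ℕ} (A : QueryAlgorithm n c₁ c₂) : ℕ :=
  ∑ j, ((A.circuit j).map Gate.evalCost).sum

/-- Total number of queries to the loading unitary and its inverse. -/
def QueryAlgorithm.loadQueries {n c₁ c₂ : ℕ} (A : QueryAlgorithm n c₁ c₂) : ℕ :=
  ∑ j, ((A.circuit j).map Gate.loadCost).sum

/-- Probability (Born's rule, independent runs) that the estimate lies within `δ` of `μ`. -/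
def QueryAlgorithm.successProb {n c₁ c₂ : ℕ} (A : QueryAlgorithm n c₁ c₂)
    (P : Matrix.unitaryGroup (BitString n) ℂ)
    (U : Matrix.unitaryGroup (BitString n × FixedPoint c₁ c₂) ℂ) (μ δ : ℝ) : ℝ :=
  ∑ o : Fin A.runs → Basis n c₁ c₂ A.anc,
    Set.indicator {o | |A.estimate o - μ| ≤ δ}
      (fun o => ∏ j, ‖finalState P U (A.circuit j) (o j)‖ ^ 2) o

/-! ### The network -/

/-- Gradient of the network output (loss included) with respect to the trainable parameters, at
parameters `θ` and input `x`. -/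
def paramGradient {d nθ : ℕ}
    (f : EuclideanSpace ℝ (Fin nθ) → EuclideanSpace ℝ (Fin d) → ℝ)
    (θ : EuclideanSpace ℝ (Fin nθ)) (x : EuclideanSpace ℝ (Fin d)) :
    EuclideanSpace ℝ (Fin nθ) :=
  gradient (fun t => f t x) θ

/-- `g_max = ‖∇f‖_∞²`: the maximum, over the inputs that occur with positive probability, of the
squared maximum norm of the gradient (`WithLp.ofLp` passes to the maximum norm). -/
def gMax {n d nθ : ℕ}
    (f : EuclideanSpace ℝ (Fin nθ) → EuclideanSpace ℝ (Fin d) → ℝ)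
    (θ : EuclideanSpace ℝ (Fin nθ)) (p : PMF (BitString n))
    (X : BitString n → EuclideanSpace ℝ (Fin d)) : ℝ :=
  ⨆ i : p.support, ‖WithLp.ofLp (paramGradient f θ (X i))‖ ^ 2

end QAMC

end

noncomputable section

namespace QAMC

open Matrix

/-! ### Squared Euclidean norms and unitary matrices -/

section LinearAlgebra

variable {ι κ : Type*} [Fintype ι] [Fintype κ]

/-! By Cauchy–Schwarz and `‖u‖₂² ≤ nθ ‖u‖∞²` (`inner_sq_le_card_mul`), the directional derivative is
at most `B = √(g nθ) ‖v‖` in absolute value on the support of `p`. The same pointwise estimate, with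
`gMax`, bounds the second moment and hence the variance. The algorithm uses only the range bound
`B`. If `B < ε`, the answer `0` is good enough.

Otherwise the stored value, clamped to `[-B, B]` and divided by `B`, becomes the upper left entry of
a qubit reflection. Conjugating by the evaluating unitary gives an involution `R₁` with `⟨ψ, R₁ ψ⟩ =
μ`, the rescaled mean, where `ψ` is the loaded state (`star_loadedState_dotProduct_evalReflection`).
With `R₀` the reflection about `ψ`, the vectors `χ t = (R₀ R₁)^t ψ` obey `χ (t+2) + χ t = 2 μ χ
(t+1)` (`reflections_pow_recurrence`). So in a superposition `∑ c t |t⟩ χ t` the path matrix on the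
time register acts almost as the scalar `μ`; the defect involves only the increments of `c`
(`sum_sqNorm_pathMatrix_sub_le`). A tent of width `2 L` makes the squared defect `O(1/L²)`.

Measuring the time register in the eigenbasis of the path matrix thus yields an eigenvalue whose
mean squared distance from `μ` is `O(1/L²)` (`sum_sq_eigenvalues_sub`, `exists_estimationCircuit`).
With `L` of order `B/ε`, one run and Chebyshev's inequality suffice, without logarithmic factors. -/

/-- The squared Euclidean norm of a complex vector. -/
def sqNorm (v : ι → ℂ) : ℝ := ∑ i, ‖v i‖ ^ 2

theorem ofReal_sqNorm (v : ι → ℂ) : (sqNorm v : ℂ) = star v ⬝ᵥ v := by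
  simp [sqNorm, dotProduct, Complex.conj_mul']

theorem sqNorm_smul (a : ℂ) (v : ι → ℂ) : sqNorm (a • v) = ‖a‖ ^ 2 * sqNorm v := by
  simp [sqNorm, mul_pow, Finset.mul_sum]

theorem sqNorm_add_le (v w : ι → ℂ) : sqNorm (v + w) ≤ 2 * sqNorm v + 2 * sqNorm w := by
  simp only [sqNorm, Finset.mul_sum, ← Finset.sum_add_distrib, Pi.add_apply]
  refine Finset.sum_le_sum fun i _ => ?_
  have h := norm_add_le (v i) (w i)
  have h0 := norm_nonneg (v i + w i)
  nlinarith [sq_nonneg (‖v i‖ - ‖w i‖)]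

section

variable [DecidableEq ι]

theorem sqNorm_mulVec {U : Matrix ι ι ℂ} (hU : U ∈ unitaryGroup ι ℂ) (v : ι → ℂ) :
    sqNorm (U *ᵥ v) = sqNorm v := by
  have h : ((sqNorm (U *ᵥ v) : ℝ) : ℂ) = sqNorm v := by
    have hU' : Uᴴ * U = 1 := mem_unitaryGroup_iff'.1 hU
    rw [ofReal_sqNorm, ofReal_sqNorm, star_mulVec, dotProduct_mulVec, vecMul_vecMul, hU',
      vecMul_one]
  exact_mod_cast h

theorem sqNorm_single (i : ι) : sqNorm (Pi.single i (1 : ℂ)) = 1 := by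
  simp [sqNorm, Pi.single_apply, apply_ite]

/-- Every unit vector is a column of a unitary matrix. -/
theorem exists_unitary_mulVec_single (i : ι) (u : ι → ℂ) (hu : sqNorm u = 1) :
    ∃ U ∈ unitaryGroup ι ℂ, U *ᵥ Pi.single i 1 = u := by
  let E := EuclideanSpace ℂ ι
  have hnorm : ‖(WithLp.toLp 2 u : E)‖ = 1 := by
    rw [EuclideanSpace.norm_eq]
    simpa [sqNorm] using hu
  have hv : Orthonormal ℂ (({i} : Set ι).domRestrict fun _ => (WithLp.toLp 2 u : E)) := by
    refine ⟨fun _ => hnorm, fun a b hab => (hab (Subsingleton.elim a b)).elim⟩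
  -- Extend `u`, placed at index `i`, to an orthonormal basis; the basis vectors are the columns of
  -- the unitary.
  obtain ⟨b, hb⟩ := hv.exists_orthonormalBasis_extension_of_card_eq (by simp)
  refine ⟨(EuclideanSpace.basisFun ι ℂ).toBasis.toMatrix b,
    OrthonormalBasis.toMatrix_orthonormalBasis_mem_unitary _ _, ?_⟩
  ext j
  simp [Module.Basis.toMatrix_apply, hb i rfl]

end

theorem kronecker_one_mulVec [DecidableEq κ] (A : Matrix ι ι ℂ) (v : ι × κ → ℂ) (i : ι) (k : κ) :
    (kronecker A (1 : Matrix κ κ ℂ) *ᵥ v) (i, k) = (A *ᵥ fun j => v (j, k)) i := by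
  simp [mulVec, dotProduct, Fintype.sum_prod_type, one_apply]

theorem one_kronecker_mulVec [DecidableEq ι] (A : Matrix κ κ ℂ) (v : ι × κ → ℂ) (i : ι) (k : κ) :
    (kronecker (1 : Matrix ι ι ℂ) A *ᵥ v) (i, k) = (A *ᵥ fun j => v (i, j)) k := by
  simp [mulVec, dotProduct, Fintype.sum_prod_type, one_apply]

theorem blockDiagonal_mulVec_apply [DecidableEq κ] (W : κ → Matrix ι ι ℂ) (v : ι × κ → ℂ)
    (i : ι) (k : κ) :
    (blockDiagonal W *ᵥ v) (i, k) = (W k *ᵥ fun j => v (j, k)) i := by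
  simp [mulVec, dotProduct, Fintype.sum_prod_type, blockDiagonal_apply]

variable [DecidableEq ι] [DecidableEq κ]

theorem kronecker_one_mem_unitary {A : Matrix ι ι ℂ} (hA : A ∈ unitaryGroup ι ℂ) :
    kronecker A (1 : Matrix κ κ ℂ) ∈ unitaryGroup (ι × κ) ℂ :=
  kronecker_mem_unitary hA (one_mem _)

theorem blockDiagonal_mem_unitary {W : κ → Matrix ι ι ℂ} (hW : ∀ k, W k ∈ unitaryGroup ι ℂ) :
    blockDiagonal W ∈ unitaryGroup (ι × κ) ℂ := by
  rw [mem_unitaryGroup_iff, star_eq_conjTranspose, blockDiagonal_conjTranspose,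
    ← blockDiagonal_mul, ← blockDiagonal_one]
  congr 1
  funext k
  exact mem_unitaryGroup_iff.1 (hW k)

theorem submatrix_mem_unitary {A : Matrix ι ι ℂ} (hA : A ∈ unitaryGroup ι ℂ) (e : κ ≃ ι) :
    A.submatrix e e ∈ unitaryGroup κ ℂ := by
  rw [mem_unitaryGroup_iff, star_eq_conjTranspose, conjTranspose_submatrix, submatrix_mul_equiv,
    ← star_eq_conjTranspose, mem_unitaryGroup_iff.1 hA, submatrix_one_equiv]

end LinearAlgebra

/-! ### Measuring a Hermitian matrix -/

section Hermitian

variable {ι : Type*} [Fintype ι] [DecidableEq ι]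

/-- Second moment, about `μ`, of the outcome of measuring a Hermitian matrix. -/
theorem sum_sq_eigenvalues_sub {T : Matrix ι ι ℂ} (hT : T.IsHermitian) (μ : ℝ) (x : ι → ℂ) :
    ∑ l, (hT.eigenvalues l - μ) ^ 2 *
        ‖(star (hT.eigenvectorUnitary : Matrix ι ι ℂ) *ᵥ x) l‖ ^ 2 =
      sqNorm (T *ᵥ x - (μ : ℂ) • x) := by
  set E : Matrix ι ι ℂ := (hT.eigenvectorUnitary : Matrix ι ι ℂ)
  have hEE : E * star E = 1 := mem_unitaryGroup_iff.1 hT.eigenvectorUnitary.2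
  have hmem : star E ∈ unitaryGroup ι ℂ := Unitary.star_mem hT.eigenvectorUnitary.2
  have hdiag : star E * T = diagonal (fun l => (hT.eigenvalues l : ℂ)) * star E := by
    have h : star E * T * E = diagonal (fun l => (hT.eigenvalues l : ℂ)) := by
      have := hT.conjStarAlgAut_star_eigenvectorUnitary
      rw [Unitary.conjStarAlgAut_star_apply] at this
      exact this
    calc star E * T = star E * T * (E * star E) := by rw [hEE, mul_one]
      _ = (star E * T * E) * star E := by simp only [mul_assoc]
      _ = _ := by rw [h]
  rw [← sqNorm_mulVec hmem (T *ᵥ x - (μ : ℂ) • x), mulVec_sub, mulVec_mulVec, hdiag,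
    ← mulVec_mulVec, mulVec_smul, sqNorm]
  refine Finset.sum_congr rfl fun l _ => ?_
  rw [Pi.sub_apply, mulVec_diagonal, Pi.smul_apply, smul_eq_mul, ← sub_mul, norm_mul, mul_pow,
    ← Complex.ofReal_sub, Complex.norm_real, Real.norm_eq_abs, sq_abs]

end Hermitian

/-! ### The walk on a path -/

/-- The transition matrix of the walk on the path `0, …, D - 1`. -/
def pathMatrix (D : ℕ) : Matrix (Fin D) (Fin D) ℂ := of fun i j =>
  (if (j : ℕ) = i + 1 then 1 / 2 else 0) + if (j : ℕ) + 1 = i then 1 / 2 else 0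

theorem pathMatrix_isHermitian (D : ℕ) : (pathMatrix D).IsHermitian := by
  ext i j
  have h : ∀ p : Prop, [Decidable p] → star (if p then (1 / 2 : ℂ) else 0) =
      if p then 1 / 2 else 0 := by
    intro p _
    split_ifs <;> simp
  rw [conjTranspose_apply, pathMatrix, of_apply, of_apply, star_add, h, h, add_comm]
  simp only [eq_comm]

theorem pathMatrix_mulVec_zero {D : ℕ} (F : ℕ → ℂ) (hD : 1 < D) :
    (pathMatrix D *ᵥ fun j => F j) ⟨0, by omega⟩ = 1 / 2 * F 1 := by
  refine (Fin.sum_univ_eq_sum_range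
    (fun j => ((if j = 0 + 1 then (1 / 2 : ℂ) else 0) + if j + 1 = 0 then 1 / 2 else 0) * F j)
    D).trans ?_
  simp [ite_mul, hD]

/-- In the last row the upper neighbour is missing from the matrix; the vanishing of `F` from `D` on
lets the formula hold there too. -/
theorem pathMatrix_mulVec_succ {D : ℕ} (F : ℕ → ℂ) (hF : ∀ j, D ≤ j → F j = 0) (t : ℕ)
    (ht : t + 1 < D) :
    (pathMatrix D *ᵥ fun j => F j) ⟨t + 1, ht⟩ = 1 / 2 * F t + 1 / 2 * F (t + 2) := by
  refine (Fin.sum_univ_eq_sum_range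
    (fun j => ((if j = t + 1 + 1 then (1 / 2 : ℂ) else 0) +
      if j + 1 = t + 1 then 1 / 2 else 0) * F j) D).trans ?_
  simp only [add_mul, Finset.sum_add_distrib, ite_mul, zero_mul, add_left_inj,
    Finset.sum_ite_eq', Finset.mem_range]
  rw [if_pos (by omega : t < D), add_comm]
  split_ifs with h
  · rfl
  · rw [hF (t + 2) (by omega), mul_zero]

section Window

variable {κ : Type*} [Fintype κ]

/-- If `χ` satisfies the recurrence of the Chebyshev polynomials at `μ`, a slowly varying
superposition of the `χ t` is almost an eigenvector of the path matrix for `μ`. -/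
theorem sum_sqNorm_pathMatrix_sub_le (χ : ℕ → κ → ℂ) (μ : ℝ)
    (hrec : ∀ t, χ (t + 2) + χ t = (2 * μ : ℂ) • χ (t + 1)) (hχ : ∀ t, sqNorm (χ t) = 1)
    (c : ℕ → ℝ) (a : ℝ) (N D : ℕ) (hND : N + 1 < D) (h0 : c 0 = 0) (hN : ∀ t, N ≤ t → c t = 0)
    (hc : ∀ t, |c (t + 1) - c t| ≤ a) :
    ∑ k : κ, sqNorm ((pathMatrix D *ᵥ fun j : Fin D => (c j : ℂ) * χ j k) -
      (μ : ℂ) • fun j : Fin D => (c j : ℂ) * χ j k) ≤ (N + 1) * a ^ 2 := by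
  have ha : ∀ t, (c (t + 1) - c t) ^ 2 ≤ a ^ 2 := fun t =>
    sq_le_sq' (abs_le.1 (hc t)).1 (abs_le.1 (hc t)).2
  simp only [sqNorm]
  rw [Finset.sum_comm]
  have key : ∀ j : Fin D, ∑ k : κ, ‖((pathMatrix D *ᵥ fun j : Fin D => (c j : ℂ) * χ j k) -
      (μ : ℂ) • fun j : Fin D => (c j : ℂ) * χ j k) j‖ ^ 2 ≤
        if (j : ℕ) < N + 1 then a ^ 2 else 0 := by
    rintro ⟨t, ht⟩
    rcases t with _ | t
    -- At the left end there is no lower neighbour, and `c 0 = 0` removes the `μ` term.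
    · have h : ∀ k : κ, ((pathMatrix D *ᵥ fun j : Fin D => (c j : ℂ) * χ j k) -
          (μ : ℂ) • fun j : Fin D => (c j : ℂ) * χ j k) ⟨0, ht⟩ =
            ((1 / 2 * c 1 : ℂ) • χ 1) k := by
        intro k
        rw [Pi.sub_apply, pathMatrix_mulVec_zero (fun j => (c j : ℂ) * χ j k) (by omega)]
        simp [h0, mul_assoc]
      simp only [h]
      change sqNorm _ ≤ _
      rw [sqNorm_smul, hχ, if_pos (by simp)]
      have := ha 0
      rw [h0] at this
      simp [mul_pow] at this ⊢
      nlinarith [sq_nonneg (c 1)]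
    · have h : ∀ k : κ, ((pathMatrix D *ᵥ fun j : Fin D => (c j : ℂ) * χ j k) -
          (μ : ℂ) • fun j : Fin D => (c j : ℂ) * χ j k) ⟨t + 1, ht⟩ =
            ((-(1 / 2) * (c (t + 1) - c t : ℝ) : ℂ) • χ t +
              (1 / 2 * (c (t + 2) - c (t + 1) : ℝ) : ℂ) • χ (t + 2)) k := by
        intro k
        rw [Pi.sub_apply, pathMatrix_mulVec_succ (fun j => (c j : ℂ) * χ j k)
          (fun j hj => by simp [hN j (by omega)]) t ht]
        have := congrFun (hrec t) k
        simp only [Pi.add_apply, Pi.smul_apply, smul_eq_mul, Complex.ofReal_sub] at this ⊢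
        -- The recurrence splits `μ c (t+1) χ (t+1)` into halves of `c (t+1) χ t` and `c (t+1) χ
        -- (t+2)`, so only increments of `c` survive.
        linear_combination ((c (t + 1) : ℂ) / 2) * this
      simp only [h]
      change sqNorm _ ≤ _
      refine (sqNorm_add_le _ _).trans ?_
      rw [sqNorm_smul, sqNorm_smul, hχ, hχ]
      simp only [norm_mul, Complex.norm_real, mul_pow, Real.norm_eq_abs, sq_abs, norm_neg]
      have h1 := ha t
      have h2 := ha (t + 1)
      norm_num
      split_ifs with hlt
      · linarith
      · rw [hN t (by omega), hN (t + 1) (by omega), hN (t + 2) (by omega)]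
        simp
  refine (Finset.sum_le_sum fun j _ => key j).trans ?_
  rw [Fin.sum_univ_eq_sum_range (fun j => if j < N + 1 then a ^ 2 else 0), ← Finset.sum_filter,
    Finset.sum_const, nsmul_eq_mul]
  have : (Finset.range D).filter (· < N + 1) = Finset.range (N + 1) := by
    ext; simp; omega
  rw [this]
  simp

/-- Bounds the normalization of the tent from below, through its rising half alone. -/
theorem cube_le_three_mul_sum_sq (L : ℕ) :
    (L : ℝ) ^ 3 ≤ 3 * ∑ t ∈ Finset.range (L + 1), (t : ℝ) ^ 2 := by
  induction L with
  | zero => simp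
  | succ L ih =>
    rw [Finset.sum_range_succ]
    push_cast at ih ⊢
    nlinarith [Nat.cast_nonneg (α := ℝ) L]

/-- A normalized tent of width `2 L`, as the amplitudes of the time register. -/
theorem exists_window (L D : ℕ) (hL : 0 < L) (hD : 2 * L + 1 < D) :
    ∃ (c : ℕ → ℝ) (a : ℝ), ∑ t : Fin D, c t ^ 2 = 1 ∧ c 0 = 0 ∧ (∀ t, 2 * L ≤ t → c t = 0) ∧
      (∀ t, |c (t + 1) - c t| ≤ a) ∧ (2 * L + 1) * a ^ 2 ≤ 9 / (L : ℝ) ^ 2 := by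
  set S : ℝ := ∑ t ∈ Finset.range D, ((min t (2 * L - t) : ℕ) : ℝ) ^ 2 with hS
  have hL' : (1 : ℝ) ≤ L := by exact_mod_cast hL
  have hSL : (L : ℝ) ^ 3 ≤ 3 * S := by
    refine (cube_le_three_mul_sum_sq L).trans ?_
    gcongr
    have hsub : Finset.range (L + 1) ⊆ Finset.range D := by
      intro t; simp; omega
    calc ∑ t ∈ Finset.range (L + 1), (t : ℝ) ^ 2
        = ∑ t ∈ Finset.range (L + 1), ((min t (2 * L - t) : ℕ) : ℝ) ^ 2 := by
          refine Finset.sum_congr rfl fun t ht => ?_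
          rw [min_eq_left]
          have := Finset.mem_range.1 ht
          omega
      _ ≤ S := Finset.sum_le_sum_of_subset_of_nonneg hsub fun _ _ _ => sq_nonneg _
  have hS0 : 0 < S := by
    have : 0 < (L : ℝ) ^ 3 := by positivity
    linarith
  -- Truncated subtraction makes the tent vanish from `2 L` on.
  refine ⟨fun t => ((min t (2 * L - t) : ℕ) : ℝ) / √S, 1 / √S, ?_, by simp, ?_, ?_, ?_⟩
  · rw [Fin.sum_univ_eq_sum_range (fun t => (((min t (2 * L - t) : ℕ) : ℝ) / √S) ^ 2)]
    simp only [div_pow, Real.sq_sqrt hS0.le]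
    rw [← Finset.sum_div, ← hS, div_self hS0.ne']
  · intro t ht
    simp [Nat.sub_eq_zero_of_le ht]
  · intro t
    rw [← sub_div, abs_div, abs_of_nonneg (Real.sqrt_nonneg S)]
    gcongr
    have h1 : (min (t + 1) (2 * L - (t + 1)) : ℕ) ≤ min t (2 * L - t) + 1 := by omega
    have h2 : (min t (2 * L - t) : ℕ) ≤ min (t + 1) (2 * L - (t + 1)) + 1 := by omega
    have h1' : ((min (t + 1) (2 * L - (t + 1)) : ℕ) : ℝ) ≤ (min t (2 * L - t) : ℕ) + 1 := by
      exact_mod_cast h1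
    have h2' : ((min t (2 * L - t) : ℕ) : ℝ) ≤ (min (t + 1) (2 * L - (t + 1)) : ℕ) + 1 := by
      exact_mod_cast h2
    rw [abs_le]
    constructor <;> linarith
  -- For `L ≥ 1`, `(2 L + 1) L² ≤ 3 L³ ≤ 9 S`.
  · rw [div_pow, Real.sq_sqrt hS0.le, one_pow, mul_one_div, div_le_div_iff₀ hS0 (by positivity)]
    nlinarith [mul_le_mul_of_nonneg_right hL' (sq_nonneg (L : ℝ))]

end Window

/-! ### Products of two reflections -/

section Reflections

variable {κ : Type*} [Fintype κ] [DecidableEq κ]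

/-- If `R₁` is an involution and `R₀` the reflection about `ψ`, the iterates of `R₀ R₁` on `ψ`
satisfy the recurrence of the Chebyshev polynomials at `⟨ψ, R₁ ψ⟩`. -/
theorem reflections_pow_recurrence (R₀ R₁ : Matrix κ κ ℂ) (ψ : κ → ℂ) (μ : ℂ)
    (h₁ : R₁ * R₁ = 1) (h₀ : ∀ x, R₀ *ᵥ x = (2 * (star ψ ⬝ᵥ x)) • ψ - x)
    (hψ : star ψ ⬝ᵥ ψ = 1) (hμ : star ψ ⬝ᵥ (R₁ *ᵥ ψ) = μ) (t : ℕ) :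
    (R₀ * R₁) ^ (t + 2) *ᵥ ψ + (R₀ * R₁) ^ t *ᵥ ψ =
      (2 * μ) • ((R₀ * R₁) ^ (t + 1) *ᵥ ψ) := by
  have hfix : R₀ *ᵥ ψ = ψ := by
    rw [h₀, hψ, mul_one, two_smul, add_sub_cancel_right]
  have hQ : (R₀ * R₁) *ᵥ ψ = (2 * μ) • ψ - R₁ *ᵥ ψ := by rw [← mulVec_mulVec, h₀, hμ]
  -- Applying `R₀ R₁` to `R₁ ψ` cancels the two copies of `R₁` and leaves `R₀ ψ = ψ`.
  have hQ2 : (R₀ * R₁) *ᵥ ((R₀ * R₁) *ᵥ ψ) = (2 * μ) • ((R₀ * R₁) *ᵥ ψ) - ψ := by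
    conv_lhs => rw [hQ]
    rw [mulVec_sub, mulVec_smul, mulVec_mulVec, mul_assoc, h₁, mul_one, hfix]
  rw [pow_succ _ (t + 1), pow_succ, ← mulVec_mulVec, ← mulVec_mulVec, hQ2, mulVec_sub,
    mulVec_smul, sub_add_cancel]
  simp only [mulVec_mulVec]

end Reflections

/-! ### The two reflections -/

section SignFlip

variable {κ : Type*} [Fintype κ]

theorem star_mulVec_dotProduct_mulVec (A B : Matrix κ κ ℂ) (x y : κ → ℂ) :
    star (A *ᵥ x) ⬝ᵥ (B *ᵥ y) = star x ⬝ᵥ ((star A * B) *ᵥ y) := by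
  rw [star_mulVec, dotProduct_mulVec, vecMul_vecMul, ← dotProduct_mulVec, star_eq_conjTranspose]

variable [DecidableEq κ]

/-- The reflection `2 |z⟩⟨z| - 1`. -/
def signFlip (z : κ) : Matrix κ κ ℂ := diagonal fun k => if k = z then 1 else -1

theorem signFlip_mem_unitary (z : κ) : signFlip z ∈ unitaryGroup κ ℂ := by
  rw [mem_unitaryGroup_iff, star_eq_conjTranspose, signFlip, diagonal_conjTranspose,
    diagonal_mul_diagonal, ← diagonal_one]
  congr 1
  funext k
  by_cases h : k = z <;> simp [h]

theorem signFlip_mulVec (z : κ) (x : κ → ℂ) :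
    signFlip z *ᵥ x = (2 * x z) • Pi.single z 1 - x := by
  ext k
  rw [signFlip, mulVec_diagonal]
  by_cases h : k = z
  · subst h
    simp
    ring
  · simp [h]

/-- Conjugating `2 |z⟩⟨z| - 1` by `A` gives the reflection about `A |z⟩`. -/
theorem conj_signFlip_mulVec {A : Matrix κ κ ℂ} (hA : A ∈ unitaryGroup κ ℂ) (z : κ) (x : κ → ℂ) :
    (A * signFlip z * star A) *ᵥ x =
      (2 * (star (A *ᵥ Pi.single z 1) ⬝ᵥ x)) • (A *ᵥ Pi.single z 1) - x := by
  have h : star (A *ᵥ Pi.single z 1) ⬝ᵥ x = (star A *ᵥ x) z := by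
    have := star_mulVec_dotProduct_mulVec A 1 (Pi.single z 1) x
    rw [one_mulVec, mul_one] at this
    rw [this, ← Pi.single_star, star_one, single_one_dotProduct]
  rw [← mulVec_mulVec, ← mulVec_mulVec, signFlip_mulVec, mulVec_sub, mulVec_smul, mulVec_mulVec x,
    mem_unitaryGroup_iff.1 hA, one_mulVec, h]

end SignFlip

section ValueReflection

/-- The real `2 × 2` reflection with upper left entry `y`. -/
def bitReflection (y : ℝ) : Matrix Bool Bool ℂ :=
  of fun b b' => if b = b' then (if b then -(y : ℂ) else y) else (√(1 - y ^ 2) : ℝ)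

theorem star_bitReflection (y : ℝ) : star (bitReflection y) = bitReflection y := by
  ext b b'
  rw [star_apply]
  cases b <;> cases b' <;> simp [bitReflection]

theorem bitReflection_mul_self {y : ℝ} (hy : |y| ≤ 1) :
    bitReflection y * bitReflection y = 1 := by
  have h : (√(1 - y ^ 2) : ℂ) * (√(1 - y ^ 2) : ℝ) = 1 - y * y := by
    have h1 : y ^ 2 ≤ 1 := (sq_le_one_iff_abs_le_one y).2 hy
    rw [← Complex.ofReal_mul, Real.mul_self_sqrt (by linarith)]
    push_cast
    ring
  ext b b'
  cases b <;> cases b' <;> simp [bitReflection, mul_apply, h] <;> ring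

variable {σ : Type*} [DecidableEq σ]

/-- The reflection of a qubit with upper left entry `y s`, controlled on the basis state `|s⟩`. -/
def valueReflection (y : σ → ℝ) : Matrix (σ × Bool) (σ × Bool) ℂ :=
  (blockDiagonal fun s => bitReflection (y s)).submatrix (Equiv.prodComm σ Bool)
    (Equiv.prodComm σ Bool)

theorem star_valueReflection (y : σ → ℝ) : star (valueReflection y) = valueReflection y := by
  rw [valueReflection, star_eq_conjTranspose, conjTranspose_submatrix, blockDiagonal_conjTranspose]
  simp only [← star_eq_conjTranspose, star_bitReflection]

variable [Fintype σ]

theorem valueReflection_mul_self {y : σ → ℝ} (hy : ∀ s, |y s| ≤ 1) :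
    valueReflection y * valueReflection y = 1 := by
  rw [valueReflection, submatrix_mul_equiv, ← blockDiagonal_mul]
  simp only [fun s => bitReflection_mul_self (hy s)]
  rw [← Pi.one_def, blockDiagonal_one, submatrix_one_equiv]

theorem valueReflection_mem_unitary {y : σ → ℝ} (hy : ∀ s, |y s| ≤ 1) :
    valueReflection y ∈ unitaryGroup (σ × Bool) ℂ := by
  rw [mem_unitaryGroup_iff, star_valueReflection, valueReflection_mul_self hy]

theorem valueReflection_mulVec_false (y : σ → ℝ) (v : σ × Bool → ℂ) (s : σ) :
    (valueReflection y *ᵥ v) (s, false) =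
      y s * v (s, false) + (√(1 - y s ^ 2) : ℝ) * v (s, true) := by
  simp [mulVec, dotProduct, Fintype.sum_prod_type, valueReflection, blockDiagonal_apply,
    bitReflection, add_comm]

end ValueReflection

/-! ### Slices of the state along a time register -/

section Slices

variable {n c₁ c₂ anc D : ℕ}

/-- The part of the machine on which the iterated unitary acts: the two queried registers and
one qubit. -/
abbrev Core (n c₁ c₂ : ℕ) : Type := (BitString n × FixedPoint c₁ c₂) × Bool

instance (n c₁ c₂ : ℕ) : DecidableEq (Core n c₁ c₂) := instDecidableEqProd

/-- The basis state `|0⋯0⟩` of the core. -/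
def coreZero (n c₁ c₂ : ℕ) : Core n c₁ c₂ := ((zeroBits n, zeroFixed c₁ c₂), false)

/-- The machine as the core together with a time register. -/
def coreEquiv (e : BitString anc ≃ Bool × Fin D) : Basis n c₁ c₂ anc ≃ Core n c₁ c₂ × Fin D :=
  ((Equiv.refl _).prodCongr e).trans (Equiv.prodAssoc _ _ _).symm

/-- The component of a state at time `t`. -/
def slice (e : BitString anc ≃ Bool × Fin D) (ψ : Basis n c₁ c₂ anc → ℂ) (t : Fin D) :
    Core n c₁ c₂ → ℂ :=
  fun k => ψ ((coreEquiv e).symm (k, t))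

theorem slice_kronecker_mulVec (e : BitString anc ≃ Bool × Fin D)
    (A : Matrix (BitString n × FixedPoint c₁ c₂) (BitString n × FixedPoint c₁ c₂) ℂ)
    (ψ : Basis n c₁ c₂ anc → ℂ) (t : Fin D) :
    slice e (kronecker A 1 *ᵥ ψ) t = kronecker A 1 *ᵥ slice e ψ t := by
  ext ⟨s, b⟩
  rw [kronecker_one_mulVec]
  exact kronecker_one_mulVec A ψ s (e.symm (b, t))

/-- Apply `W t` to the component at time `t`. -/
def timeControlled (e : BitString anc ≃ Bool × Fin D)
    (W : Fin D → Matrix (Core n c₁ c₂) (Core n c₁ c₂) ℂ) :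
    Matrix (Basis n c₁ c₂ anc) (Basis n c₁ c₂ anc) ℂ :=
  (blockDiagonal W).submatrix (coreEquiv e) (coreEquiv e)

theorem timeControlled_mem_unitary (e : BitString anc ≃ Bool × Fin D)
    {W : Fin D → Matrix (Core n c₁ c₂) (Core n c₁ c₂) ℂ}
    (hW : ∀ t, W t ∈ unitaryGroup (Core n c₁ c₂) ℂ) :
    timeControlled e W ∈ unitaryGroup (Basis n c₁ c₂ anc) ℂ :=
  submatrix_mem_unitary (blockDiagonal_mem_unitary hW) _

theorem slice_timeControlled_mulVec (e : BitString anc ≃ Bool × Fin D)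
    (W : Fin D → Matrix (Core n c₁ c₂) (Core n c₁ c₂) ℂ) (ψ : Basis n c₁ c₂ anc → ℂ)
    (t : Fin D) :
    slice e (timeControlled e W *ᵥ ψ) t = W t *ᵥ slice e ψ t := by
  ext k
  rw [slice, timeControlled, submatrix_mulVec_equiv, Function.comp_apply,
    Equiv.apply_symm_apply, blockDiagonal_mulVec_apply]
  rfl

/-- Apply `B` to the time register. -/
def onTime (e : BitString anc ≃ Bool × Fin D) (B : Matrix (Fin D) (Fin D) ℂ) :
    Matrix (Basis n c₁ c₂ anc) (Basis n c₁ c₂ anc) ℂ :=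
  (kronecker (1 : Matrix (Core n c₁ c₂) (Core n c₁ c₂) ℂ) B).submatrix (coreEquiv e) (coreEquiv e)

theorem onTime_mem_unitary (e : BitString anc ≃ Bool × Fin D) {B : Matrix (Fin D) (Fin D) ℂ}
    (hB : B ∈ unitaryGroup (Fin D) ℂ) :
    (onTime e B : Matrix (Basis n c₁ c₂ anc) (Basis n c₁ c₂ anc) ℂ) ∈
      unitaryGroup (Basis n c₁ c₂ anc) ℂ :=
  submatrix_mem_unitary (kronecker_mem_unitary (one_mem _) hB) _

theorem onTime_mulVec (e : BitString anc ≃ Bool × Fin D) (B : Matrix (Fin D) (Fin D) ℂ)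
    (ψ : Basis n c₁ c₂ anc → ℂ) (k : Core n c₁ c₂) (t : Fin D) :
    (onTime e B *ᵥ ψ) ((coreEquiv e).symm (k, t)) = (B *ᵥ fun j => slice e ψ j k) t := by
  rw [onTime, submatrix_mulVec_equiv, Function.comp_apply, Equiv.apply_symm_apply,
    one_kronecker_mulVec]
  rfl

/-- A unitary that prepares given amplitudes of the time register from `|0⋯0⟩`. -/
theorem exists_prepareTime (e : BitString anc ≃ Bool × Fin D) (c : Fin D → ℝ)
    (hc : ∑ t, c t ^ 2 = 1) :
    ∃ G ∈ unitaryGroup (Basis n c₁ c₂ anc) ℂ, ∀ t,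
      slice e (G *ᵥ ket ((zeroBits n, zeroFixed c₁ c₂), zeroBits anc)) t =
        (c t : ℂ) • Pi.single (coreZero n c₁ c₂) 1 := by
  obtain ⟨G, hG, h⟩ := exists_unitary_mulVec_single
    ((zeroBits n, zeroFixed c₁ c₂), zeroBits anc)
    (fun a : Basis n c₁ c₂ anc => if (coreEquiv e a).1 = coreZero n c₁ c₂ then
      (c (coreEquiv e a).2 : ℂ) else 0) (by
      rw [sqNorm, ← (coreEquiv e).symm.sum_comp]
      simp only [Equiv.apply_symm_apply, Fintype.sum_prod_type_right, apply_ite norm, norm_zero,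
        ite_pow, zero_pow two_ne_zero, Finset.sum_ite_eq', Finset.mem_univ, if_true,
        Complex.norm_real, Real.norm_eq_abs, sq_abs, hc])
  refine ⟨G, hG, fun t => ?_⟩
  ext k
  rw [slice, ket, h]
  by_cases hk : k = coreZero n c₁ c₂ <;> simp [hk]

end Slices

/-! ### The circuit -/

section Circuit

variable {n c₁ c₂ anc D : ℕ}

/-- One application of the iterated unitary to the components at times after `s`. -/
def iterationGates (e : BitString anc ≃ Bool × Fin D)
    (V : unitaryGroup (Core n c₁ c₂) ℂ) (s : ℕ) : List (Gate n c₁ c₂ anc) :=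
  [.eval,
    .free ⟨timeControlled e fun t => if s < t then V.1 else 1,
      timeControlled_mem_unitary e fun t => by split_ifs; exacts [V.2, one_mem _]⟩,
    .evalInv, .loadInv,
    .free ⟨timeControlled e fun t => if s < t then signFlip (coreZero n c₁ c₂) else 1,
      timeControlled_mem_unitary e fun t => by
        split_ifs; exacts [signFlip_mem_unitary _, one_mem _]⟩,
    .load]

/-- The effect of a circuit on a state. -/
def runGates (P : unitaryGroup (BitString n) ℂ)
    (U : unitaryGroup (BitString n × FixedPoint c₁ c₂) ℂ)
    (circuit : List (Gate n c₁ c₂ anc)) (ψ : Basis n c₁ c₂ anc → ℂ) : Basis n c₁ c₂ anc → ℂ :=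
  circuit.foldl (fun ψ G => G.toMatrix P U *ᵥ ψ) ψ

/-- The loading unitary on the core. -/
def coreLoad (P : unitaryGroup (BitString n) ℂ) : Matrix (Core n c₁ c₂) (Core n c₁ c₂) ℂ :=
  kronecker (kronecker P.1 1) 1

/-- The evaluating unitary on the core. -/
def coreEval (U : unitaryGroup (BitString n × FixedPoint c₁ c₂) ℂ) :
    Matrix (Core n c₁ c₂) (Core n c₁ c₂) ℂ :=
  kronecker U.1 1

theorem coreLoad_mem_unitary (P : unitaryGroup (BitString n) ℂ) :
    (coreLoad P : Matrix (Core n c₁ c₂) (Core n c₁ c₂) ℂ) ∈ unitaryGroup (Core n c₁ c₂) ℂ :=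
  kronecker_one_mem_unitary (kronecker_one_mem_unitary P.2)

theorem coreEval_mem_unitary (U : unitaryGroup (BitString n × FixedPoint c₁ c₂) ℂ) :
    coreEval U ∈ unitaryGroup (Core n c₁ c₂) ℂ :=
  kronecker_one_mem_unitary U.2

theorem coreLoad_inv (P : unitaryGroup (BitString n) ℂ) :
    (coreLoad P⁻¹ : Matrix (Core n c₁ c₂) (Core n c₁ c₂) ℂ) = star (coreLoad P) := by
  rw [coreLoad, coreLoad, star_eq_conjTranspose, kronecker, kronecker,
    conjTranspose_kronecker, conjTranspose_kronecker, conjTranspose_one, conjTranspose_one]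
  rfl

theorem coreEval_inv (U : unitaryGroup (BitString n × FixedPoint c₁ c₂) ℂ) :
    coreEval U⁻¹ = star (coreEval U) := by
  rw [coreEval, coreEval, star_eq_conjTranspose, kronecker, conjTranspose_kronecker,
    conjTranspose_one]
  rfl

/-- The reflection about the loaded state. -/
def stateReflection (P : unitaryGroup (BitString n) ℂ) :
    Matrix (Core n c₁ c₂) (Core n c₁ c₂) ℂ :=
  coreLoad P * signFlip (coreZero n c₁ c₂) * star (coreLoad P)

/-- The reflection `V`, controlled on the output register, after evaluation. -/
def evalReflection (U : unitaryGroup (BitString n × FixedPoint c₁ c₂) ℂ)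
    (V : unitaryGroup (Core n c₁ c₂) ℂ) : Matrix (Core n c₁ c₂) (Core n c₁ c₂) ℂ :=
  star (coreEval U) * V.1 * coreEval U

/-- No controlled queries are needed: where the two free gates in between are the identity, each
query cancels against its inverse. Controlling only these free gates therefore controls the whole
iteration. -/
theorem slice_iterationGates (P : unitaryGroup (BitString n) ℂ)
    (U : unitaryGroup (BitString n × FixedPoint c₁ c₂) ℂ) (e : BitString anc ≃ Bool × Fin D)
    (V : unitaryGroup (Core n c₁ c₂) ℂ) (s : ℕ) (ψ : Basis n c₁ c₂ anc → ℂ) (t : Fin D) :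
    slice e (runGates P U (iterationGates e V s) ψ) t =
      if s < t then (stateReflection P * evalReflection U V) *ᵥ slice e ψ t
      else slice e ψ t := by
  have hP : coreLoad P * star (coreLoad P) = (1 : Matrix (Core n c₁ c₂) (Core n c₁ c₂) ℂ) :=
    mem_unitaryGroup_iff.1 (coreLoad_mem_unitary P)
  have hU : star (coreEval U) * coreEval U = 1 :=
    mem_unitaryGroup_iff'.1 (coreEval_mem_unitary U)
  simp only [runGates, iterationGates, List.foldl_cons, List.foldl_nil, Gate.toMatrix,
    slice_kronecker_mulVec, slice_timeControlled_mulVec]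
  change coreLoad P *ᵥ _ *ᵥ coreLoad P⁻¹ *ᵥ coreEval U⁻¹ *ᵥ _ *ᵥ coreEval U *ᵥ _ = _
  rw [coreLoad_inv, coreEval_inv]
  split_ifs
  · simp only [mulVec_mulVec, stateReflection, evalReflection, mul_assoc]
  · rw [one_mulVec, one_mulVec, mulVec_mulVec _ (star (coreEval U)), hU, one_mulVec, mulVec_mulVec,
      hP, one_mulVec]

/-- The whole circuit: prepare the time register, load, iterate, and rotate the time register
into the basis to be measured. -/
def estimationCircuit (e : BitString anc ≃ Bool × Fin D)
    (V : unitaryGroup (Core n c₁ c₂) ℂ) (G : unitaryGroup (Basis n c₁ c₂ anc) ℂ)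
    (B : unitaryGroup (Fin D) ℂ) (N : ℕ) : List (Gate n c₁ c₂ anc) :=
  [.free G, .load] ++ (List.range N).flatMap (iterationGates e V) ++
    [.free ⟨onTime e B.1, onTime_mem_unitary e B.2⟩]

theorem runGates_append (P : unitaryGroup (BitString n) ℂ)
    (U : unitaryGroup (BitString n × FixedPoint c₁ c₂) ℂ) (l l' : List (Gate n c₁ c₂ anc))
    (ψ : Basis n c₁ c₂ anc → ℂ) :
    runGates P U (l ++ l') ψ = runGates P U l' (runGates P U l ψ) :=
  List.foldl_append

/-- Round `s` acts on the component at time `t` exactly when `s < t`, so the number of active rounds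
is `min t N`. -/
theorem slice_iterate (P : unitaryGroup (BitString n) ℂ)
    (U : unitaryGroup (BitString n × FixedPoint c₁ c₂) ℂ) (e : BitString anc ≃ Bool × Fin D)
    (V : unitaryGroup (Core n c₁ c₂) ℂ) (N : ℕ) (ψ : Basis n c₁ c₂ anc → ℂ) (t : Fin D) :
    slice e (runGates P U ((List.range N).flatMap (iterationGates e V)) ψ) t =
      (stateReflection P * evalReflection U V) ^ min (t : ℕ) N *ᵥ slice e ψ t := by
  induction N with
  | zero => simp [runGates]
  | succ N ih =>
    rw [List.range_succ, List.flatMap_append, runGates_append, List.flatMap_singleton,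
      slice_iterationGates, ih]
    split_ifs with h
    · rw [min_eq_right h.le, min_eq_right (by omega : N + 1 ≤ t), pow_succ', mulVec_mulVec]
    · rw [min_eq_left (by omega), min_eq_left (by omega)]

theorem sum_map_flatMap_iterationGates (f : Gate n c₁ c₂ anc → ℕ) (q : ℕ)
    (e : BitString anc ≃ Bool × Fin D) (V : unitaryGroup (Core n c₁ c₂) ℂ)
    (hf : ∀ s, ((iterationGates e V s).map f).sum = q) (N : ℕ) :
    (((List.range N).flatMap (iterationGates e V)).map f).sum = N * q := by
  induction N with
  | zero => simp
  | succ N ih =>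
    rw [List.range_succ, List.flatMap_append, List.map_append, List.sum_append, ih,
      List.flatMap_singleton, hf, add_mul, one_mul]

theorem evalCost_estimationCircuit (e : BitString anc ≃ Bool × Fin D)
    (V : unitaryGroup (Core n c₁ c₂) ℂ) (G : unitaryGroup (Basis n c₁ c₂ anc) ℂ)
    (B : unitaryGroup (Fin D) ℂ) (N : ℕ) :
    ((estimationCircuit e V G B N).map Gate.evalCost).sum = 2 * N := by
  rw [estimationCircuit, List.map_append, List.map_append, List.sum_append, List.sum_append,
    sum_map_flatMap_iterationGates Gate.evalCost 2 e V (fun s => rfl)]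
  simp [Gate.evalCost, mul_comm]

theorem loadCost_estimationCircuit (e : BitString anc ≃ Bool × Fin D)
    (V : unitaryGroup (Core n c₁ c₂) ℂ) (G : unitaryGroup (Basis n c₁ c₂ anc) ℂ)
    (B : unitaryGroup (Fin D) ℂ) (N : ℕ) :
    ((estimationCircuit e V G B N).map Gate.loadCost).sum = 2 * N + 1 := by
  rw [estimationCircuit, List.map_append, List.map_append, List.sum_append, List.sum_append,
    sum_map_flatMap_iterationGates Gate.loadCost 2 e V (fun s => rfl)]
  simp [Gate.loadCost, mul_comm, add_comm]

end Circuit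

/-! ### The mean as a matrix element -/

section Mean

variable {n c₁ c₂ : ℕ}

/-- The state `∑ₓ √(p x) |x⟩|0⟩|0⟩`. -/
def loadedState (P : unitaryGroup (BitString n) ℂ) : Core n c₁ c₂ → ℂ :=
  coreLoad P *ᵥ Pi.single (coreZero n c₁ c₂) 1

theorem loadedState_apply {p : PMF (BitString n)} {P : unitaryGroup (BitString n) ℂ}
    (hP : LoadsDistribution p P) (x : BitString n) (q : FixedPoint c₁ c₂) (b : Bool) :
    loadedState P ((x, q), b) =
      if q = zeroFixed c₁ c₂ ∧ b = false then ((√(p x).toReal : ℝ) : ℂ) else 0 := by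
  rw [loadedState, coreLoad, kronecker_one_mulVec, kronecker_one_mulVec]
  split_ifs with h
  · obtain ⟨rfl, rfl⟩ := h
    rw [← congrFun hP x]
    congr 2
    ext j
    simp [coreZero, ket, Pi.single_apply]
  · have : (fun j => (Pi.single (coreZero n c₁ c₂) 1 : Core n c₁ c₂ → ℂ) ((j, q), b)) = 0 := by
      ext j
      simp only [coreZero, Pi.single_apply, Prod.mk.injEq, Pi.zero_apply, ite_eq_right_iff]
      tauto
    rw [this, mulVec_zero, Pi.zero_apply]

/-- The loaded state has a blank output register, so only the columns of `U` fixed by `Writes`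
enter; the rest of `U` is arbitrary. -/
theorem coreEval_mulVec_loadedState {p : PMF (BitString n)} {P : unitaryGroup (BitString n) ℂ}
    {U : unitaryGroup (BitString n × FixedPoint c₁ c₂) ℂ} {w : BitString n → FixedPoint c₁ c₂}
    (hP : LoadsDistribution p P) (hU : Writes w U) (x : BitString n) (q : FixedPoint c₁ c₂)
    (b : Bool) :
    (coreEval U *ᵥ loadedState P) ((x, q), b) =
      if q = w x ∧ b = false then ((√(p x).toReal : ℝ) : ℂ) else 0 := by
  have hcol : ∀ x', U.1 (x, q) (x', zeroFixed c₁ c₂) = if x' = x ∧ q = w x then 1 else 0 := by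
    intro x'
    have := congrFun (hU x') (x, q)
    rw [ket, mulVec_single_one, ket, Pi.single_apply] at this
    rw [← col_apply U.1, this]
    simp only [Prod.mk.injEq]
    refine if_congr ⟨?_, ?_⟩ rfl rfl
    · rintro ⟨rfl, h⟩; exact ⟨rfl, h⟩
    · rintro ⟨rfl, h⟩; exact ⟨rfl, h⟩
  rw [coreEval, kronecker_one_mulVec]
  simp only [mulVec, dotProduct, Fintype.sum_prod_type (f := fun j : BitString n × FixedPoint c₁ c₂
    => _), loadedState_apply hP]
  by_cases hb : b = false
  · simp only [hb, and_true, mul_ite, mul_zero, Finset.sum_ite_eq', Finset.mem_univ, if_true, hcol]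
    by_cases hq : q = w x <;> simp [hq]
  · simp [hb]

/-- Moving the evaluation to both sides leaves `V` between copies of `∑ √(p x) |x⟩|w x⟩|0⟩`. It
preserves both registers, so each `x` contributes only its upper left entry `y (w x)`, with weight
`p x`. -/
theorem star_loadedState_dotProduct_evalReflection {p : PMF (BitString n)}
    {P : unitaryGroup (BitString n) ℂ} {U : unitaryGroup (BitString n × FixedPoint c₁ c₂) ℂ}
    {w : BitString n → FixedPoint c₁ c₂} (hP : LoadsDistribution p P) (hU : Writes w U)
    (y : FixedPoint c₁ c₂ → ℝ) (V : unitaryGroup (Core n c₁ c₂) ℂ)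
    (hV : V.1 = valueReflection fun s => y s.2) :
    star (loadedState P) ⬝ᵥ (evalReflection U V *ᵥ loadedState P) =
      ((∑ x, (p x).toReal * y (w x) : ℝ) : ℂ) := by
  have h := star_mulVec_dotProduct_mulVec (coreEval U) (V.1 * coreEval U) (loadedState P)
    (loadedState P)
  rw [← mulVec_mulVec, ← mul_assoc] at h
  rw [evalReflection, ← h, hV, dotProduct,
    Fintype.sum_prod_type, Fintype.sum_prod_type]
  simp only [Fintype.sum_bool, Pi.star_apply,
    coreEval_mulVec_loadedState hP hU, valueReflection_mulVec_false]
  push_cast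
  refine Finset.sum_congr rfl fun x _ => ?_
  have hs : (√(p x).toReal : ℂ) * (√(p x).toReal : ℝ) = ((p x).toReal : ℝ) := by
    rw [← Complex.ofReal_mul, Real.mul_self_sqrt ENNReal.toReal_nonneg]
  rw [Finset.sum_eq_single (w x)]
  · simp
    rw [← hs]
    ring
  · intro q _ hq
    simp [hq]
  · simp

end Mean

/-! ### Estimating the mean of a bounded function of the stored value -/

section Estimation

variable {n c₁ c₂ : ℕ}

/-- A circuit with `O(L)` queries whose outcome has mean squared error `O(1 / L ^ 2)` as an
estimate of the mean of `y (w x)`. -/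
theorem exists_estimationCircuit (n : ℕ) {c₁ c₂ : ℕ} (y : FixedPoint c₁ c₂ → ℝ)
    (hy : ∀ q, |y q| ≤ 1) (L : ℕ) (hL : 0 < L) :
    ∃ (anc : ℕ) (circuit : List (Gate n c₁ c₂ anc)) (est : Basis n c₁ c₂ anc → ℝ),
      (circuit.map Gate.evalCost).sum = 4 * L ∧ (circuit.map Gate.loadCost).sum = 4 * L + 1 ∧
      ∀ (p : PMF (BitString n)) (P : unitaryGroup (BitString n) ℂ)
        (U : unitaryGroup (BitString n × FixedPoint c₁ c₂) ℂ) (w : BitString n → FixedPoint c₁ c₂),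
        LoadsDistribution p P → Writes w U →
        sqNorm (finalState P U circuit) = 1 ∧
        ∑ o, (est o - ∑ x, (p x).toReal * y (w x)) ^ 2 * ‖finalState P U circuit o‖ ^ 2 ≤
          9 / (L : ℝ) ^ 2 := by
  -- Ancillas are not counted, so a generous power of two serves as `D`; one ancilla beyond the time
  -- register is the qubit of the core.
  obtain ⟨D, hD, e⟩ : ∃ D, 2 * L + 1 < D ∧
      Nonempty (BitString (2 * L + 1 + 1) ≃ Bool × Fin D) :=
    ⟨2 ^ (2 * L + 1), Nat.lt_two_pow_self,
      ⟨Fintype.equivOfCardEq (by simp [pow_succ, mul_comm])⟩⟩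
  obtain ⟨e⟩ := e
  obtain ⟨c, a, hc, h0, hN, hca, ha⟩ := exists_window L D hL hD
  obtain ⟨G, hG, hGs⟩ := exists_prepareTime (n := n) (c₁ := c₁) (c₂ := c₂) e (fun t => c t) hc
  have hT := pathMatrix_isHermitian D
  let V : unitaryGroup (Core n c₁ c₂) ℂ :=
    ⟨valueReflection fun s => y s.2, valueReflection_mem_unitary fun s => hy s.2⟩
  -- After this rotation, reading the time register measures the path matrix, and the estimate is
  -- the corresponding eigenvalue.
  let B : unitaryGroup (Fin D) ℂ := star hT.eigenvectorUnitary
  refine ⟨_, estimationCircuit e V ⟨G, hG⟩ B (2 * L), fun o => hT.eigenvalues (coreEquiv e o).2,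
    ?_, ?_, ?_⟩
  · rw [evalCost_estimationCircuit]; ring
  · rw [loadCost_estimationCircuit]; ring
  intro p P U w hP hU
  set μ : ℝ := ∑ x, (p x).toReal * y (w x) with hμ
  set ψ : Core n c₁ c₂ → ℂ := loadedState P with hψ
  let χ : ℕ → Core n c₁ c₂ → ℂ := fun t => (stateReflection P * evalReflection U V) ^ t *ᵥ ψ
  have hψ1 : sqNorm ψ = 1 := by
    rw [hψ, loadedState, sqNorm_mulVec (coreLoad_mem_unitary P), sqNorm_single]
  have hstate : stateReflection P ∈ unitaryGroup (Core n c₁ c₂) ℂ :=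
    mul_mem (mul_mem (coreLoad_mem_unitary P) (signFlip_mem_unitary _))
      (Unitary.star_mem (coreLoad_mem_unitary P))
  have heval : evalReflection U V ∈ unitaryGroup (Core n c₁ c₂) ℂ :=
    mul_mem (mul_mem (Unitary.star_mem (coreEval_mem_unitary U)) V.2) (coreEval_mem_unitary U)
  have hinv : evalReflection U V * evalReflection U V = 1 := by
    have h1 : coreEval U * star (coreEval U) = 1 :=
      mem_unitaryGroup_iff.1 (coreEval_mem_unitary U)
    have h2 : V.1 * V.1 = 1 := valueReflection_mul_self fun s => hy s.2
    calc evalReflection U V * evalReflection U V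
        = star (coreEval U) * V.1 * (coreEval U * star (coreEval U)) * V.1 * coreEval U := by
          simp only [evalReflection, mul_assoc]
      _ = star (coreEval U) * (V.1 * V.1) * coreEval U := by
          rw [h1, mul_one]; simp only [mul_assoc]
      _ = 1 := by
          rw [h2, mul_one, mem_unitaryGroup_iff'.1 (coreEval_mem_unitary U)]
  have hrec : ∀ t, χ (t + 2) + χ t = (2 * μ : ℂ) • χ (t + 1) :=
    reflections_pow_recurrence _ _ ψ μ hinv
      (conj_signFlip_mulVec (coreLoad_mem_unitary P) (coreZero n c₁ c₂))
      (by rw [← ofReal_sqNorm, hψ1, Complex.ofReal_one])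
      (star_loadedState_dotProduct_evalReflection hP hU y V rfl)
  have hχ : ∀ t, sqNorm (χ t) = 1 := fun t => by
    rw [sqNorm_mulVec (pow_mem (mul_mem hstate heval) t), hψ1]
  have hfin : ∀ k l, finalState P U (estimationCircuit e V ⟨G, hG⟩ B (2 * L))
      ((coreEquiv e).symm (k, l)) = (B.1 *ᵥ fun j : Fin D => (c j : ℂ) * χ j k) l := by
    intro k l
    change runGates P U (_ ++ _ ++ _) _ _ = _
    rw [runGates_append, runGates_append]
    change (onTime e B.1 *ᵥ _) _ = _
    rw [onTime_mulVec]
    congr 2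
    funext j
    rw [slice_iterate]
    change (_ *ᵥ slice e (kronecker (kronecker P.1 1) 1 *ᵥ (G *ᵥ _)) j) k = _
    rw [slice_kronecker_mulVec, hGs, mulVec_smul, mulVec_smul, Pi.smul_apply, smul_eq_mul]
    -- Beyond time `2 L` the power stops growing, but the amplitude is zero there.
    by_cases hj : (j : ℕ) ≤ 2 * L
    · rw [min_eq_left hj]
      rfl
    · rw [hN j (by omega), Complex.ofReal_zero, zero_mul, zero_mul]
  constructor
  · rw [sqNorm, ← (coreEquiv e).symm.sum_comp, Fintype.sum_prod_type]
    simp only [hfin]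
    calc ∑ k, sqNorm (B.1 *ᵥ fun j : Fin D => (c j : ℂ) * χ j k)
        = ∑ k, sqNorm fun j : Fin D => (c j : ℂ) * χ j k :=
          Finset.sum_congr rfl fun k _ => sqNorm_mulVec B.2 _
      _ = ∑ j : Fin D, sqNorm ((c j : ℂ) • χ j) := Finset.sum_comm
      _ = 1 := by
          simp only [sqNorm_smul, hχ, mul_one, Complex.norm_real, Real.norm_eq_abs, sq_abs, hc]
  · rw [← (coreEquiv e).symm.sum_comp, Fintype.sum_prod_type]
    simp only [hfin, Equiv.apply_symm_apply]
    refine le_trans (le_of_eq (Finset.sum_congr rfl fun k _ =>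
      sum_sq_eigenvalues_sub hT μ fun j : Fin D => (c j : ℂ) * χ j k)) ?_
    refine (sum_sqNorm_pathMatrix_sub_le χ μ hrec hχ c a (2 * L) D hD h0 hN hca).trans ?_
    exact_mod_cast ha

/-- The algorithm that runs a single circuit. -/
def singleRun {anc : ℕ} (circuit : List (Gate n c₁ c₂ anc)) (est : Basis n c₁ c₂ anc → ℝ) :
    QueryAlgorithm n c₁ c₂ where
  anc := anc
  runs := 1
  circuit := fun _ => circuit
  estimate := fun o => est (o 0)

theorem evalQueries_singleRun {anc : ℕ} (circuit : List (Gate n c₁ c₂ anc))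
    (est : Basis n c₁ c₂ anc → ℝ) :
    (singleRun circuit est).evalQueries = (circuit.map Gate.evalCost).sum :=
  Fin.sum_univ_one _

theorem loadQueries_singleRun {anc : ℕ} (circuit : List (Gate n c₁ c₂ anc))
    (est : Basis n c₁ c₂ anc → ℝ) :
    (singleRun circuit est).loadQueries = (circuit.map Gate.loadCost).sum :=
  Fin.sum_univ_one _

theorem successProb_singleRun {anc : ℕ} (circuit : List (Gate n c₁ c₂ anc))
    (est : Basis n c₁ c₂ anc → ℝ) (P : unitaryGroup (BitString n) ℂ)
    (U : unitaryGroup (BitString n × FixedPoint c₁ c₂) ℂ) (μ δ : ℝ) :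
    (singleRun circuit est).successProb P U μ δ =
      ∑ o, if |est o - μ| ≤ δ then ‖finalState P U circuit o‖ ^ 2 else 0 := by
  refine Fintype.sum_equiv (Equiv.funUnique (Fin 1) (Basis n c₁ c₂ anc)) _ _ fun o => ?_
  classical
  refine (Set.indicator_apply _ _ _).trans ?_
  exact if_congr Iff.rfl (Fin.prod_univ_one _) rfl

/-- Chebyshev's inequality for a single run, whose outcome estimates `m`, as an estimate of `μ`. -/
theorem one_sub_le_successProb_singleRun {anc : ℕ} (circuit : List (Gate n c₁ c₂ anc))
    (est : Basis n c₁ c₂ anc → ℝ) (P : unitaryGroup (BitString n) ℂ)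
    (U : unitaryGroup (BitString n × FixedPoint c₁ c₂) ℂ) {m μ ε η ρ : ℝ} (hε : 0 < ε)
    (hm : |m - μ| ≤ η) (hnorm : sqNorm (finalState P U circuit) = 1)
    (hvar : ∑ o, (est o - m) ^ 2 * ‖finalState P U circuit o‖ ^ 2 ≤ ρ * ε ^ 2) :
    1 - ρ ≤ (singleRun circuit est).successProb P U μ (ε + η) := by
  rw [successProb_singleRun, ← hnorm]
  have hρ : ∑ o, (est o - m) ^ 2 * ‖finalState P U circuit o‖ ^ 2 / ε ^ 2 ≤ ρ := by
    rw [← Finset.sum_div, div_le_iff₀ (by positivity)]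
    exact hvar
  refine (sub_le_sub_left hρ _).trans ?_
  rw [sqNorm, ← Finset.sum_sub_distrib]
  refine Finset.sum_le_sum fun o _ => ?_
  split_ifs with h
  · have : 0 ≤ (est o - m) ^ 2 * ‖finalState P U circuit o‖ ^ 2 / ε ^ 2 := by positivity
    linarith
  -- An outcome farther than `ε + η` from `μ` is farther than `ε` from `m`, so its probability is
  -- dominated by its term in the scaled second moment.
  · have h1 : ε < |est o - m| := by
      have := abs_sub_le (est o) m μ
      linarith
    have h2 : ε ^ 2 ≤ (est o - m) ^ 2 := by
      rw [← sq_abs (est o - m)]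
      gcongr
    rw [sub_nonpos, le_div_iff₀ (by positivity), mul_comm]
    gcongr

/-- The algorithm that makes no queries and answers `0`. -/
def zeroAlgorithm (n c₁ c₂ : ℕ) : QueryAlgorithm n c₁ c₂ where
  anc := 0
  runs := 0
  circuit := Fin.elim0
  estimate := fun _ => 0

theorem evalQueries_zeroAlgorithm : (zeroAlgorithm n c₁ c₂).evalQueries = 0 :=
  Fin.sum_univ_zero _

theorem loadQueries_zeroAlgorithm : (zeroAlgorithm n c₁ c₂).loadQueries = 0 :=
  Fin.sum_univ_zero _

theorem successProb_zeroAlgorithm (P : unitaryGroup (BitString n) ℂ)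
    (U : unitaryGroup (BitString n × FixedPoint c₁ c₂) ℂ) {μ δ : ℝ} (h : |μ| ≤ δ) :
    (zeroAlgorithm n c₁ c₂).successProb P U μ δ = 1 := by
  refine (Fintype.sum_unique (ι := Fin 0 → Basis n c₁ c₂ 0) _).trans ?_
  refine (Set.indicator_of_mem ?_ _).trans (Fin.prod_univ_zero _)
  change |(0 : ℝ) - μ| ≤ δ
  rwa [zero_sub, abs_neg]

end Estimation

/-! ### Bounds on the directional derivative -/

section Gradient

/-- Projection onto an interval brings no point farther from a point of the interval. Clamping the
stored values thus costs nothing beyond their rounding error. -/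
theorem abs_clamp_sub_le {B t z : ℝ} (hz : |z| ≤ B) : |max (-B) (min B t) - z| ≤ |t - z| := by
  obtain ⟨h1, h2⟩ := abs_le.1 hz
  have h3 := le_abs_self (t - z)
  have h4 := neg_abs_le (t - z)
  rw [abs_le]
  constructor
  · rcases le_total B t with h | h <;>
      simp only [h, min_eq_left, min_eq_right] <;>
      have := le_max_right (-B) B <;> have := le_max_right (-B) t <;> linarith
  · rw [sub_le_iff_le_add, max_le_iff]
    exact ⟨by linarith [abs_nonneg (t - z)], (min_le_right _ _).trans (by linarith)⟩

theorem inner_sq_le_card_mul {m : ℕ} (u v : EuclideanSpace ℝ (Fin m)) :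
    inner ℝ u v ^ 2 ≤ ‖WithLp.ofLp u‖ ^ 2 * m * ‖v‖ ^ 2 := by
  have h1 : inner ℝ u v ^ 2 ≤ ‖u‖ ^ 2 * ‖v‖ ^ 2 := by
    rw [← mul_pow]
    exact sq_le_sq' (neg_le_of_abs_le (abs_real_inner_le_norm u v)) (real_inner_le_norm u v)
  refine h1.trans (mul_le_mul_of_nonneg_right ?_ (sq_nonneg _))
  rw [EuclideanSpace.norm_sq_eq]
  refine (Finset.sum_le_card_nsmul Finset.univ _ (‖WithLp.ofLp u‖ ^ 2) fun i _ => ?_).trans ?_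
  · gcongr
    exact norm_le_pi_norm (WithLp.ofLp u) i
  · simp [mul_comm]

variable {n d nθ : ℕ} {f : EuclideanSpace ℝ (Fin nθ) → EuclideanSpace ℝ (Fin d) → ℝ}
  {θ : EuclideanSpace ℝ (Fin nθ)} {p : PMF (BitString n)}
  {X : BitString n → EuclideanSpace ℝ (Fin d)}

theorem inner_paramGradient_sq_le (v : EuclideanSpace ℝ (Fin nθ)) {i : BitString n}
    (hi : i ∈ p.support) :
    inner ℝ (paramGradient f θ (X i)) v ^ 2 ≤ gMax f θ p X * nθ * ‖v‖ ^ 2 := by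
  refine (inner_sq_le_card_mul _ v).trans ?_
  gcongr
  exact le_ciSup (f := fun i : p.support => ‖WithLp.ofLp (paramGradient f θ (X i))‖ ^ 2)
    (Set.finite_range _).bddAbove ⟨i, hi⟩

end Gradient

/-! ### Means and variances over a finite distribution -/

section FiniteMeans

variable {ι : Type*} [Fintype ι]

theorem sum_toReal_eq_one (p : PMF ι) : ∑ i, (p i).toReal = 1 := by
  rw [← ENNReal.toReal_sum fun i _ => p.apply_ne_top i,
    ← tsum_fintype (L := .unconditional ι) (fun i => p i), p.tsum_coe, ENNReal.toReal_one]

/-- A bound on the support is enough, since all other points have weight zero. -/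
theorem sum_toReal_mul_le (p : PMF ι) {z : ι → ℝ} {η : ℝ} (h : ∀ i ∈ p.support, z i ≤ η) :
    ∑ i, (p i).toReal * z i ≤ η := by
  calc ∑ i, (p i).toReal * z i ≤ ∑ i, (p i).toReal * η := by
        refine Finset.sum_le_sum fun i _ => ?_
        by_cases hi : i ∈ p.support
        · exact mul_le_mul_of_nonneg_left (h i hi) ENNReal.toReal_nonneg
        · simp [(p.apply_eq_zero_iff i).2 hi]
    _ = η := by rw [← Finset.sum_mul, sum_toReal_eq_one, one_mul]

theorem abs_sum_toReal_mul_le (p : PMF ι) {z : ι → ℝ} {η : ℝ} (h : ∀ i ∈ p.support, |z i| ≤ η) :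
    |∑ i, (p i).toReal * z i| ≤ η := by
  refine (Finset.abs_sum_le_sum_abs _ _).trans ?_
  simp only [abs_mul, abs_of_nonneg ENNReal.toReal_nonneg]
  exact sum_toReal_mul_le p h

variable [MeasurableSpace ι] [MeasurableSingletonClass ι]

theorem variance_toMeasure_le (p : PMF ι) {z : ι → ℝ} {b : ℝ} (h : ∀ i ∈ p.support, z i ^ 2 ≤ b) :
    ProbabilityTheory.variance z p.toMeasure ≤ b := by
  refine (ProbabilityTheory.variance_le_expectation_sq
    (measurable_of_finite z).aestronglyMeasurable).trans ?_
  rw [PMF.integral_eq_sum]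
  exact sum_toReal_mul_le p h

end FiniteMeans

end QAMC

/-! ### Choice of parameters and the two regimes -/

theorem mainTheorem4 :
    -- the constants hidden in `Õ`
    ∃ (C : ℝ) (k : ℕ), 0 < C ∧
    -- sizes, the fixed sample `v`, the accuracy `ε` and the bound `g` on `g_max`
    ∀ (d nθ n c₁ c₂ : ℕ) (v : EuclideanSpace ℝ (Fin nθ)) (ε g : ℝ), 0 < ε → 0 ≤ g →
    ∃ A : QAMC.QueryAlgorithm n c₁ c₂,
      (A.evalQueries : ℝ) ≤
        C * (Real.sqrt (g * nθ) * ‖v‖ / ε) *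
          Real.log (2 + Real.sqrt (g * nθ) * ‖v‖ / ε) ^ k ∧
      (A.loadQueries : ℝ) ≤
        C * (Real.sqrt (g * nθ) * ‖v‖ / ε) *
          Real.log (2 + Real.sqrt (g * nθ) * ‖v‖ / ε) ^ k ∧
      -- the network, its parameters, the random input `X` with law `p`
      ∀ (f : EuclideanSpace ℝ (Fin nθ) → EuclideanSpace ℝ (Fin d) → ℝ)
        (θ : EuclideanSpace ℝ (Fin nθ))
        (p : PMF (QAMC.BitString n))
        (X : QAMC.BitString n → EuclideanSpace ℝ (Fin d)),
        (∀ i ∈ p.support, DifferentiableAt ℝ (fun t => f t (X i)) θ) →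
        QAMC.gMax f θ p X ≤ g →
        ProbabilityTheory.variance
            (fun i => inner ℝ (QAMC.paramGradient f θ (X i)) v) p.toMeasure
          ≤ QAMC.gMax f θ p X * nθ * ‖v‖ ^ 2 ∧
        -- the two unitaries; `η` bounds the rounding error of the stored values
        ∀ (P : Matrix.unitaryGroup (QAMC.BitString n) ℂ)
          (U : Matrix.unitaryGroup (QAMC.BitString n × QAMC.FixedPoint c₁ c₂) ℂ)
          (w : QAMC.BitString n → QAMC.FixedPoint c₁ c₂) (η : ℝ),
          QAMC.LoadsDistribution p P →
          QAMC.Writes w U →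
          (∀ i ∈ p.support,
            |QAMC.fixedPointValue (w i) - inner ℝ (QAMC.paramGradient f θ (X i)) v| ≤ η) →
          (0.99 : ℝ) ≤ A.successProb P U
            (∫ i, inner ℝ (QAMC.paramGradient f θ (X i)) v ∂p.toMeasure) (ε + η) := by
  refine ⟨125, 0, by norm_num, fun d nθ n c₁ c₂ v ε g hε hg => ?_⟩
  simp only [pow_zero, mul_one]
  set B : ℝ := Real.sqrt (g * nθ) * ‖v‖ with hB
  have hB0 : 0 ≤ B := by positivity
  have hbound : ∀ (f : EuclideanSpace ℝ (Fin nθ) → EuclideanSpace ℝ (Fin d) → ℝ)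
      (θ : EuclideanSpace ℝ (Fin nθ)) (p : PMF (QAMC.BitString n))
      (X : QAMC.BitString n → EuclideanSpace ℝ (Fin d)), QAMC.gMax f θ p X ≤ g →
      ∀ i ∈ p.support, |inner ℝ (QAMC.paramGradient f θ (X i)) v| ≤ B := by
    intro f θ p X hgm i hi
    refine abs_le_of_sq_le_sq ((QAMC.inner_paramGradient_sq_le v hi).trans ?_) hB0
    rw [hB, mul_pow, Real.sq_sqrt (by positivity)]
    gcongr
  -- For `B < ε` the budget may be below one query, so none is made. Otherwise `B / ε ≥ 1` absorbs
  -- the rounding of `L` and the initial load.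
  rcases lt_or_ge B ε with hlt | hge
  · refine ⟨QAMC.zeroAlgorithm n c₁ c₂, ?_, ?_, fun f θ p X _ hgm =>
      ⟨QAMC.variance_toMeasure_le p fun i hi => QAMC.inner_paramGradient_sq_le v hi,
        fun P U w η _ _ hη => ?_⟩⟩
    · rw [QAMC.evalQueries_zeroAlgorithm, Nat.cast_zero]
      positivity
    · rw [QAMC.loadQueries_zeroAlgorithm, Nat.cast_zero]
      positivity
    -- Nonnegativity of `η` follows from the error bound at a point of the support.
    · have hη0 : 0 ≤ η := by
        obtain ⟨i, hi⟩ := p.support_nonempty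
        exact (abs_nonneg _).trans (hη i hi)
      rw [QAMC.successProb_zeroAlgorithm]
      · norm_num
      · rw [PMF.integral_eq_sum]
        refine (QAMC.abs_sum_toReal_mul_le p (hbound f θ p X hgm)).trans ?_
        linarith
  · have hBpos : 0 < B := hε.trans_le hge
    set r : ℝ := B / ε with hr
    have hr1 : 1 ≤ r := (one_le_div hε).2 hge
    -- The factor `30` turns the error `9 r² / L²` into at most `1/100`. The load count is `4 L + 1
    -- ≤ 120 r + 5 ≤ 125 r`, whence the constant `125`.
    set L : ℕ := ⌈30 * r⌉₊ with hLdef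
    have hL : 30 * r ≤ L := Nat.le_ceil _
    have hL' : (L : ℝ) < 30 * r + 1 := Nat.ceil_lt_add_one (by linarith)
    have hLpos : 0 < L := Nat.ceil_pos.2 (by linarith)
    -- Clamping is needed because the reflection must be unitary on every bit pattern, including
    -- values that rounding pushes out of range.
    let y : QAMC.FixedPoint c₁ c₂ → ℝ := fun q => max (-B) (min B (QAMC.fixedPointValue q)) / B
    have hy : ∀ q, |y q| ≤ 1 := by
      intro q
      rw [abs_div, abs_of_pos hBpos, div_le_one hBpos, abs_le]
      exact ⟨le_max_left _ _, max_le (by linarith) (min_le_left _ _)⟩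
    obtain ⟨anc, circuit, est, heval, hload, hest⟩ :=
      QAMC.exists_estimationCircuit n y hy L hLpos
    refine ⟨QAMC.singleRun circuit fun o => B * est o, ?_, ?_, fun f θ p X _ hgm =>
      ⟨QAMC.variance_toMeasure_le p fun i hi => QAMC.inner_paramGradient_sq_le v hi,
        fun P U w η hP hU hη => ?_⟩⟩
    · rw [QAMC.evalQueries_singleRun, heval]
      push_cast
      linarith
    · rw [QAMC.loadQueries_singleRun, hload]
      push_cast
      linarith
    · obtain ⟨hnorm, hvar⟩ := hest p P U w hP hU
      have h := QAMC.one_sub_le_successProb_singleRun circuit (fun o => B * est o) P U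
        (m := B * ∑ x, (p x).toReal * y (w x))
        (μ := ∫ i, inner ℝ (QAMC.paramGradient f θ (X i)) v ∂p.toMeasure) (η := η)
        (ρ := 0.01) hε ?_ hnorm ?_
      · exact le_trans (by norm_num) h
      · rw [PMF.integral_eq_sum, Finset.mul_sum, ← Finset.sum_sub_distrib]
        have heq : ∀ x, B * ((p x).toReal * y (w x)) -
            (p x).toReal • inner ℝ (QAMC.paramGradient f θ (X x)) v =
            (p x).toReal * (max (-B) (min B (QAMC.fixedPointValue (w x))) -
              inner ℝ (QAMC.paramGradient f θ (X x)) v) := by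
          intro x
          simp only [y, smul_eq_mul]
          field_simp
        simp only [heq]
        exact QAMC.abs_sum_toReal_mul_le p fun i hi =>
          (QAMC.abs_clamp_sub_le (hbound f θ p X hgm i hi)).trans (hη i hi)
      · simp only [← mul_sub, mul_pow, mul_assoc]
        rw [← Finset.mul_sum]
        have hBr : B = r * ε := by rw [hr, div_mul_cancel₀ _ hε.ne']
        have hL0 : (0 : ℝ) < L := by exact_mod_cast hLpos
        calc B ^ 2 * _ ≤ B ^ 2 * (9 / (L : ℝ) ^ 2) := by gcongr
          _ = r ^ 2 * 9 / (L : ℝ) ^ 2 * ε ^ 2 := by rw [hBr]; ring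
          _ ≤ 0.01 * ε ^ 2 := by
            gcongr
            rw [div_le_iff₀ (by positivity)]
            nlinarith

end
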